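/- Let $(M,g)$ be a smooth connected Hausdorff pseudo-Riemannian manifold (metric of arbitrary signature) of dimension $n\ge 5$ with Levi-Civita connection $\nabla$. Let $R_{jkl}{}^m$ be the Riemann tensor, with sign fixed by $(\nabla_j\nabla_k-\nabla_k\nabla_j)\omega_l=R_{jkl}{}^m\omega_m$ for covector fields $\omega$, let $R_{kl}=-R_{mkl}{}^m$ be the Ricci tensor, $R=g^{ij}R_{ij}$ the curvature scalar, and let $$C_{jkl}{}^m=R_{jkl}{}^m+\frac{1}{n-2}\left(\delta_j{}^mR_{kl}-\delta_k{}^mR_{jl}+R_j{}^mg_{kl}-R_k{}^mg_{jl}\right)-R\,\frac{\delta_j{}^mg_{kl}-\delta_k{}^mg_{jl}}{(n-1)(n-2)}$$ be the Weyl tensor, with $C_{jklm}=C_{jkl}{}^pg_{pm}$. Suppose that $(M,g)$ is conformally recurrent, i.e. there is a smooth covector field $\alpha_i$, not identically zero, with $$\nabla_iC_{jklm}=\alpha_iC_{jklm}.$$ Then at every point where $\alpha^2=\alpha_i\alpha^i\ne 0$ (in particular on all of $M$ if $\alpha^2$ vanishes nowhere) the tensor $$E_{il}=\frac{\alpha^j\alpha^k}{\alpha^2}\,C_{ijkl}$$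 is Weyl compatible: $$E_{im}C_{jkl}{}^m+E_{jm}C_{kil}{}^m+E_{km}C_{ijl}{}^m=0 .$$ -/

import Mathlib

open scoped Manifold ContDiff

noncomputable section

/-! Index calculus for a metric given by its matrix of components `G` on (an open subset of)
`ℝⁿ`.  All index positions are those of the function arguments, from left to right. -/

/-- The coordinate space `ℝⁿ`. -/
abbrev Coord (n : ℕ) : Type := EuclideanSpace ℝ (Fin n)

/-- The `i`-th partial derivative of a real function on `ℝⁿ`. -/
def partialD {n : ℕ} (i : Fin n) (f : Coord n → ℝ) (x : Coord n) : ℝ :=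
  fderiv ℝ f x (EuclideanSpace.single i (1 : ℝ))

namespace LocalMetric

variable {n : ℕ} (G : Coord n → Matrix (Fin n) (Fin n) ℝ)

/-- Christoffel symbols of the Levi-Civita connection:
`christoffel G k i j = Γᵏᵢⱼ = ½ gᵏˡ (∂ᵢ gⱼₗ + ∂ⱼ gᵢₗ - ∂ₗ gᵢⱼ)`. -/
def christoffel (k i j : Fin n) (x : Coord n) : ℝ :=
  (1 / 2 : ℝ) * ∑ l, (G x)⁻¹ k l *
    (partialD i (fun y => G y j l) x + partialD j (fun y => G y i l) x
      - partialD l (fun y => G y i j) x)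

/-- The Riemann tensor `riemann G j k l m = R_{jkl}{}^m`, with the sign convention
`(∇ⱼ∇ₖ - ∇ₖ∇ⱼ) ω_l = R_{jkl}{}^m ω_m` for covector fields `ω`. -/
def riemann (j k l m : Fin n) (x : Coord n) : ℝ :=
  partialD k (christoffel G m j l) x - partialD j (christoffel G m k l) x
    + ∑ p, (christoffel G p j l x * christoffel G m k p x
      - christoffel G p k l x * christoffel G m j p x)

/-- The Ricci tensor `R_{kl} = - R_{mkl}{}^m`. -/
def ricci (k l : Fin n) (x : Coord n) : ℝ :=
  -∑ m, riemann G m k l m x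

/-- The Ricci tensor with its second index raised, `R_j{}^m = R_{jp} g^{pm}`. -/
def ricciUp (j m : Fin n) (x : Coord n) : ℝ :=
  ∑ p, ricci G j p x * (G x)⁻¹ p m

/-- The curvature scalar `R = g^{ij} R_{ij}`. -/
def scalarCurv (x : Coord n) : ℝ :=
  ∑ i, ∑ j, (G x)⁻¹ i j * ricci G i j x

/-- Kronecker's delta `δ_j{}^m`. -/
def delta (j m : Fin n) : ℝ := if j = m then 1 else 0

/-- The Weyl tensor with its last index up, `weylUp G j k l m = C_{jkl}{}^m`. -/
def weylUp (j k l m : Fin n) (x : Coord n) : ℝ :=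
  riemann G j k l m x
    + (1 / ((n : ℝ) - 2)) *
      (delta j m * ricci G k l x - delta k m * ricci G j l x
        + ricciUp G j m x * G x k l - ricciUp G k m x * G x j l)
    - scalarCurv G x * (delta j m * G x k l - delta k m * G x j l)
        / (((n : ℝ) - 1) * ((n : ℝ) - 2))

/-- The fully covariant Weyl tensor `weyl G j k l m = C_{jklm} = C_{jkl}{}^p g_{pm}`. -/
def weyl (j k l m : Fin n) (x : Coord n) : ℝ :=
  ∑ p, weylUp G j k l p x * G x p m

/-- The Levi-Civita covariant derivative `∇ᵢ T_{jklm}` of a covariant tensor of rank four. -/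
def covDeriv4 (T : Fin n → Fin n → Fin n → Fin n → Coord n → ℝ)
    (i j k l m : Fin n) (x : Coord n) : ℝ :=
  partialD i (T j k l m) x
    - ∑ p, (christoffel G p i j x * T p k l m x + christoffel G p i k x * T j p l m x
      + christoffel G p i l x * T j k p m x + christoffel G p i m x * T j k l p x)

/-- The contravariant components `aⁱ = g^{ij} aⱼ` of a covector field. -/
def raise (a : Fin n → Coord n → ℝ) (i : Fin n) (x : Coord n) : ℝ :=
  ∑ j, (G x)⁻¹ i j * a j x

/-- The square `a² = aᵢ aⁱ` of a covector field. -/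
def normSq (a : Fin n → Coord n → ℝ) (x : Coord n) : ℝ :=
  ∑ i, a i x * raise G a i x

/-- The tensor `E_{il} = C_{ijkl} aʲ aᵏ / a²`. -/
def electric (a : Fin n → Coord n → ℝ) (i l : Fin n) (x : Coord n) : ℝ :=
  (∑ j, ∑ k, weyl G i j k l x * raise G a j x * raise G a k x) / normSq G a x

/-- A tensor `T_{ij}` is Weyl compatible at `x` if
`T_{im} C_{jkl}{}^m + T_{jm} C_{kil}{}^m + T_{km} C_{ijl}{}^m = 0` there. -/
def WeylCompatibleAt (T : Fin n → Fin n → Coord n → ℝ) (x : Coord n) : Prop :=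
  ∀ i j k l : Fin n,
    ∑ m, (T i m x * weylUp G j k l m x + T j m x * weylUp G k i l m x
      + T k m x * weylUp G i j l m x) = 0

end LocalMetric

/-! Smooth manifolds modelled on `ℝⁿ`. -/

section Manifold

variable (n : ℕ) (M : Type*) [TopologicalSpace M] [ChartedSpace (Coord n) M]

/-- The smooth charts of `M`: the members of its maximal smooth atlas. -/
abbrev smoothCharts : Set (OpenPartialHomeomorph M (Coord n)) :=
  IsManifold.maximalAtlas (𝓡 n) ∞ M

variable {n M}

/-- The coordinate vector `∂ᵢ` of the chart `e` at the point with coordinates `y`. -/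
def coordVec (e : OpenPartialHomeomorph M (Coord n)) (i : Fin n) (y : Coord n) :
    TangentSpace (𝓡 n) (e.symm y) :=
  mfderiv (𝓡 n) (𝓡 n) e.symm y (EuclideanSpace.single i (1 : ℝ) : Coord n)

variable (n M)

/-- A pseudo-Riemannian metric: a nondegenerate symmetric bilinear form of arbitrary signature on
each tangent space, with smooth components in every smooth chart. -/
structure PseudoRiemannianMetric where
  /-- The bilinear form on the tangent space at `p`. -/
  form (p : M) : TangentSpace (𝓡 n) p →ₗ[ℝ] TangentSpace (𝓡 n) p →ₗ[ℝ] ℝ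
  symm (p : M) (v w : TangentSpace (𝓡 n) p) : form p v w = form p w v
  nondegenerate (p : M) (v : TangentSpace (𝓡 n) p) : (∀ w, form p v w = 0) → v = 0
  smooth : ∀ e ∈ smoothCharts n M, ∀ i j : Fin n,
    ContDiffOn ℝ ∞ (fun y => form (e.symm y) (coordVec e i y) (coordVec e j y)) e.target

/-- A smooth covector field. -/
structure CovectorField where
  /-- The linear form on the tangent space at `p`. -/
  form (p : M) : TangentSpace (𝓡 n) p →ₗ[ℝ] ℝ
  smooth : ∀ e ∈ smoothCharts n M, ∀ i : Fin n,
    ContDiffOn ℝ ∞ (fun y => form (e.symm y) (coordVec e i y)) e.target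

variable {n M}

/-- The components `gᵢⱼ` of a metric in the chart `e`, as functions of the coordinates. -/
def PseudoRiemannianMetric.comp (g : PseudoRiemannianMetric n M)
    (e : OpenPartialHomeomorph M (Coord n)) (y : Coord n) : Matrix (Fin n) (Fin n) ℝ :=
  Matrix.of fun i j => g.form (e.symm y) (coordVec e i y) (coordVec e j y)

/-- The components `αᵢ` of a covector field in the chart `e`, as functions of the coordinates. -/
def CovectorField.comp (α : CovectorField n M)
    (e : OpenPartialHomeomorph M (Coord n)) (i : Fin n) (y : Coord n) : ℝ :=
  α.form (e.symm y) (coordVec e i y)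

/-- `(M, g)` is conformally recurrent with recurrence vector `α`: the covector field `α` is not
identically zero, and `∇ᵢ C_{jklm} = αᵢ C_{jklm}` in every smooth chart. -/
def PseudoRiemannianMetric.IsConformallyRecurrent (g : PseudoRiemannianMetric n M)
    (α : CovectorField n M) : Prop :=
  (∃ p : M, α.form p ≠ 0) ∧
  ∀ e ∈ smoothCharts n M, ∀ y ∈ e.target, ∀ i j k l m : Fin n,
    LocalMetric.covDeriv4 (g.comp e) (LocalMetric.weyl (g.comp e)) i j k l m y
      = α.comp e i y * LocalMetric.weyl (g.comp e) j k l m y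

end Manifold

end

/-! Recurrence turns the second Bianchi identity of the Weyl tensor into algebra at one point.
Writing `C` as Riemann plus the product of `g` with the Schouten tensor, the cyclic sum of `∇ᵢ
C_{jklm}` loses its Riemann part and leaves `g` times a Cotton-type tensor `T`
(`covDeriv4_weyl_cyclic`). Recurrence replaces the left side by `uᵢ C_{jklm}` + cyclic, with `u = α`
at the point.

Let `v` be `u` with its index raised, `s = u·v`, `D_{jkl} = vᵐ C_{jklm}`, and `e` the unnormalised
electric part. Since `C` is trace-free, tracing the identity gives `D = (3 - n) T`
(`cotton_of_recurrent`). Contracting it with `v` in the last slot gives `(4 - n)(uᵢ D_{jkl} +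
cyclic) = 0`, which is where dimension four must be excluded. One more contraction yields `s D_{jkl}
= u_j e_{kl} - u_k e_{jl}`.

Contracting the original identity with `v` in the cyclic slot then expresses `s C` through `g`, `u`,
`D` and `e`. As `s ≠ 0`, the Weyl tensor is determined by `g`, `u` and `e`. Contracted with `e`, it
involves only `g`, `u`, `e` and the square of `e`, because `e` annihilates `v`; both `e` and its
square are symmetric, so the cyclic sum cancels (`electric_compatible_of_recurrent`).

The rest derives the required symmetries and the Bianchi identity from the coordinate formulas, and
checks that chart components of the metric are smooth and invertible. -/

/-! ### Algebra of a conformal curvature tensor at a point -/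

section Pointwise

variable {n : ℕ} {g h : Matrix (Fin n) (Fin n) ℝ}

/-- Contracting `g` with its inverse renames an index. -/
theorem sum_inverse_metric (hgh : g * h = 1) (hg : ∀ i j, g i j = g j i)
    (j : Fin n) (X : Fin n → ℝ) : ∑ i, ∑ m, h i m * (g j m * X i) = X j := by
  have h1 : h * g = 1 := mul_eq_one_comm.mp hgh
  have h2 : ∀ i, ∑ m, h i m * (g j m * X i) = (1 : Matrix (Fin n) (Fin n) ℝ) i j * X i := by
    intro i
    rw [← h1, Matrix.mul_apply, Finset.sum_mul]
    exact Finset.sum_congr rfl fun m _ => by rw [hg j m]; ring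
  simp [h2, Matrix.one_apply]

variable {C : Fin n → Fin n → Fin n → Fin n → ℝ} {u v : Fin n → ℝ}
  {T D : Fin n → Fin n → Fin n → ℝ} {e : Fin n → Fin n → ℝ}

/-- The tensor `T` in the Bianchi identity of a recurrent Weyl tensor is a multiple of the
contraction of the Weyl tensor with the recurrence vector. -/
theorem cotton_of_recurrent (hn : 5 ≤ n) (hgh : g * h = 1) (hg : ∀ i j, g i j = g j i)
    (hh : ∀ i j, h i j = h j i)
    (hC : ∀ j k l m, C j k l m = -C k j l m) (hC' : ∀ j k l m, C j k l m = -C j k m l)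
    (htr : ∀ k l, ∑ i, ∑ m, h i m * C i k l m = 0)
    (hv : ∀ i, v i = ∑ j, h i j * u j)
    (hT : ∀ i k l, T i k l = -T k i l)
    (hD : ∀ j k l, D j k l = ∑ m, v m * C j k l m)
    (hB : ∀ i j k l m, u i * C j k l m + u j * C k i l m + u k * C i j l m
      = g j m * T i k l - g j l * T i k m + g k m * T j i l - g k l * T j i m
        + g i m * T k j l - g i l * T k j m) (j k l : Fin n) :
    (3 - n : ℝ) * T j k l = D j k l := by
  have hn' : (5 : ℝ) ≤ n := by exact_mod_cast hn
  have htr2 : ∀ k l, ∑ i, ∑ m, h i m * C k i l m = 0 := by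
    intro k l
    have : ∑ i, ∑ m, h i m * C k i l m = -∑ i, ∑ m, h i m * C i k l m := by
      simp only [← Finset.sum_neg_distrib]
      exact Finset.sum_congr rfl fun i _ => Finset.sum_congr rfl fun m _ => by rw [hC]; ring
    rw [this, htr, neg_zero]
  obtain ⟨t, ht⟩ : ∃ t : Fin n → ℝ, ∀ k, t k = ∑ i, ∑ m, h i m * T i k m := ⟨_, fun _ => rfl⟩
  have ht2 : ∀ k, ∑ i, ∑ m, h i m * T k i m = -t k := by
    intro k
    rw [ht]
    simp only [← Finset.sum_neg_distrib]
    exact Finset.sum_congr rfl fun i _ => Finset.sum_congr rfl fun m _ => by rw [hT]; ring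
  have hgg : ∑ i, ∑ m, h i m * g i m = n := by
    have : ∀ i, ∑ m, h i m * g i m = 1 := by
      intro i
      have h1 := congrFun (congrFun (mul_eq_one_comm.mp hgh : h * g = 1) i) i
      rw [Matrix.mul_apply, Matrix.one_apply_eq] at h1
      rw [← h1]
      exact Finset.sum_congr rfl fun m _ => by rw [hg i m]
    simp [this]
  have hu : ∀ j k l, ∑ i, ∑ m, h i m * (u i * C j k l m) = D j k l := by
    intro j k l
    rw [hD, Finset.sum_comm]
    refine Finset.sum_congr rfl fun m _ => ?_
    rw [hv, Finset.sum_mul]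
    exact Finset.sum_congr rfl fun i _ => by rw [hh]; ring
  -- The trace of `hB` over `i` and `m`: the trace-free property leaves only `D` on the left, and `3
  -- - n` collects `n` from the trace of `g` and three index renamings.
  have key : ∀ j k l, D j k l = (3 - n : ℝ) * T j k l - g j l * t k + g k l * t j := by
    intro j k l
    have h0 : ∑ i, ∑ m, h i m * (u i * C j k l m + u j * C k i l m + u k * C i j l m)
        = ∑ i, ∑ m, h i m * (g j m * T i k l - g j l * T i k m + g k m * T j i l
          - g k l * T j i m + g i m * T k j l - g i l * T k j m) :=
      Finset.sum_congr rfl fun i _ => Finset.sum_congr rfl fun m _ => by rw [hB]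
    have hL : ∑ i, ∑ m, h i m * (u i * C j k l m + u j * C k i l m + u k * C i j l m)
        = ∑ i, ∑ m, h i m * (u i * C j k l m) + u j * ∑ i, ∑ m, h i m * C k i l m
          + u k * ∑ i, ∑ m, h i m * C i j l m := by
      simp only [Finset.mul_sum, ← Finset.sum_add_distrib]
      exact Finset.sum_congr rfl fun i _ => Finset.sum_congr rfl fun m _ => by ring
    have hR : ∑ i, ∑ m, h i m * (g j m * T i k l - g j l * T i k m + g k m * T j i l
          - g k l * T j i m + g i m * T k j l - g i l * T k j m)
        = ∑ i, ∑ m, h i m * (g j m * T i k l) - g j l * ∑ i, ∑ m, h i m * T i k m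
          + ∑ i, ∑ m, h i m * (g k m * T j i l) - g k l * ∑ i, ∑ m, h i m * T j i m
          + T k j l * ∑ i, ∑ m, h i m * g i m - ∑ m, ∑ i, h m i * (g l i * T k j m) := by
      rw [Finset.sum_comm (f := fun m i => h m i * (g l i * T k j m))]
      simp only [Finset.mul_sum, ← Finset.sum_add_distrib, ← Finset.sum_sub_distrib]
      exact Finset.sum_congr rfl fun i _ => Finset.sum_congr rfl fun m _ => by
        rw [hh m i, hg l i]; ring
    rw [hL, hR, hu, htr, htr2, sum_inverse_metric hgh hg j (fun i => T i k l),
      sum_inverse_metric hgh hg k (fun i => T j i l),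
      sum_inverse_metric hgh hg l (fun i => T k j i), ht2, hgg, ← ht, hT k j l] at h0
    linear_combination h0
  -- A second trace: `D` is trace-free because `C` is, and the right side of `key` traces to `(3 -
  -- n) - n + 1 = 4 - 2n` times `t`.
  have htz : ∀ k, t k = 0 := by
    intro k
    have h1 : ∑ j, ∑ l, h j l * D j k l = 0 := by
      have : ∀ j l, h j l * D j k l = ∑ m, -(v m * (h j l * C j k m l)) := by
        intro j l
        rw [hD, Finset.mul_sum]
        exact Finset.sum_congr rfl fun m _ => by rw [hC' j k l m]; ring
      simp only [this]
      have h2 : ∀ j, ∑ l, ∑ m, -(v m * (h j l * C j k m l))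
          = ∑ m, ∑ l, -(v m * (h j l * C j k m l)) := fun j => Finset.sum_comm
      simp only [h2]
      rw [Finset.sum_comm]
      refine Finset.sum_eq_zero fun m _ => ?_
      simp only [Finset.sum_neg_distrib, ← Finset.mul_sum, htr, mul_zero, neg_zero]
    have h3 : ∑ j, ∑ l, h j l * D j k l = (3 - n : ℝ) * ∑ j, ∑ l, h j l * T j k l
        - t k * ∑ j, ∑ l, h j l * g j l + ∑ j, ∑ l, h j l * (g k l * t j) := by
      simp only [Finset.mul_sum, ← Finset.sum_add_distrib, ← Finset.sum_sub_distrib]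
      exact Finset.sum_congr rfl fun i _ => Finset.sum_congr rfl fun m _ => by
        rw [key]; ring
    rw [h1, ← ht, hgg, sum_inverse_metric hgh hg k t] at h3
    have h4 : (4 - 2 * n : ℝ) * t k = 0 := by linear_combination -h3
    exact (mul_eq_zero.mp h4).resolve_left (by linarith)
  rw [key j k l, htz, htz]; ring

/-- A Weyl tensor whose cyclic sum with a vector `u` is pure trace is compatible with its
electric part along `u`. -/
theorem electric_compatible_of_recurrent (hn : 5 ≤ n) (hgh : g * h = 1)
    (hg : ∀ i j, g i j = g j i) (hh : ∀ i j, h i j = h j i)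
    (hC : ∀ j k l m, C j k l m = -C k j l m) (hC' : ∀ j k l m, C j k l m = -C j k m l)
    (hCp : ∀ j k l m, C j k l m = C l m j k)
    (htr : ∀ k l, ∑ i, ∑ m, h i m * C i k l m = 0)
    (hv : ∀ i, v i = ∑ j, h i j * u j)
    (hT : ∀ i k l, T i k l = -T k i l)
    (hB : ∀ i j k l m, u i * C j k l m + u j * C k i l m + u k * C i j l m
      = g j m * T i k l - g j l * T i k m + g k m * T j i l - g k l * T j i m
        + g i m * T k j l - g i l * T k j m)
    (hs : ∑ i, u i * v i ≠ 0)
    (he : ∀ i l, e i l = ∑ j, ∑ k, C i j k l * v j * v k) (i j k l : Fin n) :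
    ∑ m, ∑ p, h p m * (e i m * C j k l p + e j m * C k i l p + e k m * C i j l p) = 0 := by
  have hn' : (5 : ℝ) ≤ n := by exact_mod_cast hn
  obtain ⟨D, hD⟩ : ∃ D : Fin n → Fin n → Fin n → ℝ, ∀ j k l, D j k l = ∑ m, v m * C j k l m :=
    ⟨_, fun _ _ _ => rfl⟩
  obtain ⟨s, hs'⟩ : ∃ s : ℝ, s = ∑ i, u i * v i := ⟨_, rfl⟩
  rw [← hs'] at hs
  have hTD := cotton_of_recurrent hn hgh hg hh hC hC' htr hv hT hD hB
  have hgv : ∀ j, ∑ m, v m * g j m = u j := by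
    intro j
    have h1 := sum_inverse_metric hgh hg j u
    rw [← h1, Finset.sum_comm]
    refine Finset.sum_congr rfl fun m _ => ?_
    rw [hv, Finset.sum_mul]
    exact Finset.sum_congr rfl fun p _ => by rw [hh m p]; ring
  have hDa : ∀ j k l, D j k l = -D k j l := by
    intro j k l
    rw [hD, hD, ← Finset.sum_neg_distrib]
    exact Finset.sum_congr rfl fun m _ => by rw [hC]; ring
  have hDe : ∀ k l, ∑ i, v i * D i k l = e k l := by
    intro k l
    rw [he]
    refine Finset.sum_congr rfl fun i _ => ?_
    rw [hD, Finset.mul_sum]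
    exact Finset.sum_congr rfl fun m _ => by rw [hC, hC']; ring
  have hDe' : ∀ k l, ∑ i, v i * D k i l = -e k l := by
    intro k l
    rw [← hDe, ← Finset.sum_neg_distrib]
    exact Finset.sum_congr rfl fun i _ => by rw [hDa]; ring
  have hes : ∀ k l, e k l = e l k := by
    intro k l
    rw [he, he, Finset.sum_comm]
    exact Finset.sum_congr rfl fun i _ => Finset.sum_congr rfl fun m _ => by
      rw [hCp, hC, hC']; ring
  have hDv : ∀ j k, ∑ l, v l * D j k l = 0 := by
    intro j k
    have h1 : ∑ l, v l * D j k l = ∑ l, ∑ m, v l * v m * C j k l m :=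
      Finset.sum_congr rfl fun l _ => by
        rw [hD, Finset.mul_sum]; exact Finset.sum_congr rfl fun m _ => by ring
    have h2 : ∑ l, ∑ m, v l * v m * C j k l m = -∑ l, ∑ m, v l * v m * C j k l m := by
      conv_lhs => rw [Finset.sum_comm]
      simp only [← Finset.sum_neg_distrib]
      exact Finset.sum_congr rfl fun l _ => Finset.sum_congr rfl fun m _ => by rw [hC']; ring
    rw [h1]; linarith
  have hev : ∀ k, ∑ l, v l * e k l = 0 := by
    intro k
    have : ∀ l, v l * e k l = ∑ i, v i * (v l * D i k l) := fun l => by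
      rw [← hDe, Finset.mul_sum]; exact Finset.sum_congr rfl fun m _ => by ring
    simp only [this]
    rw [Finset.sum_comm]
    exact Finset.sum_eq_zero fun i _ => by rw [← Finset.mul_sum, hDv, mul_zero]
  -- Contract `hB` with `v` in the slot `m`, with `T` replaced by `D / (3 - n)`. The terms with `vᵐ
  -- D_{ikm}` vanish and the others reproduce minus the cyclic sum, so the coefficient is `(3 - n) +
  -- 1 = 4 - n`, nonzero since `n ≥ 5`.
  have hcyc : ∀ i j k l, u i * D j k l + u j * D k i l + u k * D i j l = 0 := by
    intro i j k l
    have h1 : ∑ m, v m * ((3 - n : ℝ) * (u i * C j k l m + u j * C k i l m + u k * C i j l m))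
        = ∑ m, v m * (g j m * D i k l - g j l * D i k m + g k m * D j i l - g k l * D j i m
        + g i m * D k j l - g i l * D k j m) :=
      Finset.sum_congr rfl fun m _ => by
        rw [hB, ← hTD, ← hTD, ← hTD, ← hTD, ← hTD, ← hTD]; ring
    have h2 : ∑ m, v m * ((3 - n : ℝ) * (u i * C j k l m + u j * C k i l m + u k * C i j l m))
        = (3 - n : ℝ) * u i * ∑ m, v m * C j k l m + (3 - n : ℝ) * u j * ∑ m, v m * C k i l m
          + (3 - n : ℝ) * u k * ∑ m, v m * C i j l m := by
      simp only [Finset.mul_sum, ← Finset.sum_add_distrib]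
      exact Finset.sum_congr rfl fun m _ => by ring
    have h3 : ∑ m, v m * (g j m * D i k l - g j l * D i k m + g k m * D j i l - g k l * D j i m
        + g i m * D k j l - g i l * D k j m)
        = D i k l * ∑ m, v m * g j m - g j l * ∑ m, v m * D i k m + D j i l * ∑ m, v m * g k m
          - g k l * ∑ m, v m * D j i m + D k j l * ∑ m, v m * g i m
          - g i l * ∑ m, v m * D k j m := by
      simp only [Finset.mul_sum, ← Finset.sum_add_distrib, ← Finset.sum_sub_distrib]
      exact Finset.sum_congr rfl fun m _ => by ring
    rw [h2, h3, ← hD, ← hD, ← hD, hDv, hDv, hDv, hgv, hgv, hgv, hDa i k, hDa j i, hDa k j] at h1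
    have h4 : (4 - n : ℝ) * (u i * D j k l + u j * D k i l + u k * D i j l) = 0 := by
      linear_combination h1
    exact (mul_eq_zero.mp h4).resolve_left (by linarith)
  have hsD : ∀ j k l, s * D j k l = u j * e k l - u k * e j l := by
    intro j k l
    have h1 : ∑ i, v i * (u i * D j k l + u j * D k i l + u k * D i j l) = 0 :=
      Finset.sum_eq_zero fun i _ => by rw [hcyc, mul_zero]
    have h2 : ∑ i, v i * (u i * D j k l + u j * D k i l + u k * D i j l)
        = D j k l * ∑ i, u i * v i + u j * ∑ i, v i * D k i l + u k * ∑ i, v i * D i j l := by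
      simp only [Finset.mul_sum, ← Finset.sum_add_distrib]
      exact Finset.sum_congr rfl fun m _ => by ring
    rw [h2, hDe, hDe', ← hs'] at h1
    linear_combination h1
  -- Here `hB` is contracted with `v` in the slot `i`; pair symmetry turns the two contractions on a
  -- first-pair index of `C` into values of `D`.
  have hsC : ∀ j k l m, (3 - n : ℝ) * (s * C j k l m + u j * D l m k - u k * D l m j)
      = g j m * e k l - g j l * e k m - g k m * e j l + g k l * e j m
        + u m * D k j l - u l * D k j m := by
    intro j k l m
    have h1 : ∑ i, v i * ((3 - n : ℝ) * (u i * C j k l m + u j * C k i l m + u k * C i j l m))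
        = ∑ i, v i * (g j m * D i k l - g j l * D i k m + g k m * D j i l - g k l * D j i m
        + g i m * D k j l - g i l * D k j m) :=
      Finset.sum_congr rfl fun i _ => by
        rw [hB, ← hTD, ← hTD, ← hTD, ← hTD, ← hTD, ← hTD]; ring
    have h2 : ∑ i, v i * ((3 - n : ℝ) * (u i * C j k l m + u j * C k i l m + u k * C i j l m))
        = (3 - n : ℝ) * C j k l m * ∑ i, u i * v i + (3 - n : ℝ) * u j * ∑ i, v i * C l m k i
          - (3 - n : ℝ) * u k * ∑ i, v i * C l m j i := by
      simp only [Finset.mul_sum, ← Finset.sum_add_distrib, ← Finset.sum_sub_distrib]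
      exact Finset.sum_congr rfl fun i _ => by rw [hCp k i, hC i j, hCp j i]; ring
    have h3 : ∑ i, v i * (g j m * D i k l - g j l * D i k m + g k m * D j i l - g k l * D j i m
        + g i m * D k j l - g i l * D k j m)
        = g j m * ∑ i, v i * D i k l - g j l * ∑ i, v i * D i k m + g k m * ∑ i, v i * D j i l
          - g k l * ∑ i, v i * D j i m + D k j l * ∑ i, v i * g m i
          - D k j m * ∑ i, v i * g l i := by
      simp only [Finset.mul_sum, ← Finset.sum_add_distrib, ← Finset.sum_sub_distrib]
      exact Finset.sum_congr rfl fun i _ => by rw [hg m i, hg l i]; ring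
    rw [h2, h3, ← hD, ← hD, ← hs', hDe, hDe, hDe', hDe', hgv, hgv] at h1
    linear_combination h1
  -- `f` is `e` with its second index raised, and `q` below is the square of `e` with respect to the
  -- metric.
  obtain ⟨f, hf⟩ : ∃ f : Fin n → Fin n → ℝ, ∀ i p, f i p = ∑ m, h p m * e i m :=
    ⟨_, fun _ _ => rfl⟩
  have hfu : ∀ i, ∑ p, f i p * u p = 0 := by
    intro i
    rw [← hev i]
    simp only [hf, Finset.sum_mul]
    rw [Finset.sum_comm]
    refine Finset.sum_congr rfl fun m _ => ?_
    rw [hv, Finset.sum_mul]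
    exact Finset.sum_congr rfl fun p _ => by rw [hh p m]; ring
  have hfg : ∀ i j, ∑ p, f i p * g j p = e i j := by
    intro i j
    rw [← sum_inverse_metric hgh hg j (e i), Finset.sum_comm]
    simp only [hf, Finset.sum_mul]
    exact Finset.sum_congr rfl fun p _ => Finset.sum_congr rfl fun m _ => by rw [hh p m]; ring
  obtain ⟨q, hq⟩ : ∃ q : Fin n → Fin n → ℝ, ∀ i j, q i j = ∑ p, f i p * e j p :=
    ⟨_, fun _ _ => rfl⟩
  have hqs : ∀ i j, q i j = q j i := by
    intro i j
    rw [hq, hq]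
    simp only [hf, Finset.sum_mul]
    rw [Finset.sum_comm]
    exact Finset.sum_congr rfl fun p _ => Finset.sum_congr rfl fun m _ => by rw [hh]; ring
  have hX : ∀ i j k l, (3 - n : ℝ) * s * s * ∑ p, f i p * C j k l p
      = (3 - n : ℝ) * (-u j * u l * q i k + u k * u l * q i j)
        + s * (e i j * e k l - g j l * q i k - e i k * e j l + g k l * q i j)
        - u l * (u k * q i j - u j * q i k) := by
    intro i j k l
    have h1 : (3 - n : ℝ) * s * s * ∑ p, f i p * C j k l p
        = (3 - n : ℝ) * (-u j * u l * ∑ p, f i p * e k p + u j * e l k * ∑ p, f i p * u p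
            + u k * u l * ∑ p, f i p * e j p - u k * e l j * ∑ p, f i p * u p)
          + s * (e k l * ∑ p, f i p * g j p - g j l * ∑ p, f i p * e k p
            - e j l * ∑ p, f i p * g k p + g k l * ∑ p, f i p * e j p)
          + (u k * e j l - u j * e k l) * ∑ p, f i p * u p
          - u l * (u k * ∑ p, f i p * e j p - u j * ∑ p, f i p * e k p) := by
      simp only [Finset.mul_sum, ← Finset.sum_add_distrib, ← Finset.sum_sub_distrib]
      refine Finset.sum_congr rfl fun p _ => ?_
      rw [hes k p, hes j p]
      have e1 := hes k p
      have e2 := hes j p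
      -- `hsC` is multiplied by one more `s` so that `hsD` can eliminate every `D`; this accounts
      -- for the factor `s * s`.
      linear_combination f i p * s * hsC j k l p - f i p * (3 - n : ℝ) * u j * hsD l p k
        + f i p * (3 - n : ℝ) * u k * hsD l p j + f i p * u p * hsD k j l
        - f i p * u l * hsD k j p - f i p * (u k * u l - s * g k l) * e2
        - f i p * (s * g j l - u j * u l) * e1
    rw [h1, hfu, hfg, hfg, ← hq, ← hq]
    ring
  have hgoal : ∑ m, ∑ p, h p m * (e i m * C j k l p + e j m * C k i l p + e k m * C i j l p)
      = ∑ p, f i p * C j k l p + ∑ p, f j p * C k i l p + ∑ p, f k p * C i j l p := by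
    rw [Finset.sum_comm]
    simp only [← Finset.sum_add_distrib, hf, Finset.sum_mul]
    exact Finset.sum_congr rfl fun p _ => Finset.sum_congr rfl fun m _ => by ring
  rw [hgoal]
  have hz : (3 - n : ℝ) * s * s * (∑ p, f i p * C j k l p + ∑ p, f j p * C k i l p
      + ∑ p, f k p * C i j l p) = 0 := by
    rw [mul_add, mul_add, hX, hX, hX, hqs j i, hqs k i, hqs k j, hes j i, hes k i, hes k j]
    ring
  exact (mul_eq_zero.mp hz).resolve_left
    (mul_ne_zero (mul_ne_zero (by linarith) hs) hs)

end Pointwise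

/-! ### Partial derivatives of functions and of matrices of functions -/

section PartialDerivatives

variable {n : ℕ} {f f' : Coord n → ℝ} {x : Coord n}

theorem partialD_add (i : Fin n) (hf : ContDiffAt ℝ ∞ f x) (hf' : ContDiffAt ℝ ∞ f' x) :
    partialD i (fun y => f y + f' y) x = partialD i f x + partialD i f' x := by
  unfold partialD
  rw [fderiv_fun_add (hf.differentiableAt (by simp)) (hf'.differentiableAt (by simp))]
  rfl

theorem partialD_sub (i : Fin n) (hf : ContDiffAt ℝ ∞ f x) (hf' : ContDiffAt ℝ ∞ f' x) :
    partialD i (fun y => f y - f' y) x = partialD i f x - partialD i f' x := by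
  unfold partialD
  rw [fderiv_fun_sub (hf.differentiableAt (by simp)) (hf'.differentiableAt (by simp))]
  rfl

theorem partialD_mul (i : Fin n) (hf : ContDiffAt ℝ ∞ f x) (hf' : ContDiffAt ℝ ∞ f' x) :
    partialD i (fun y => f y * f' y) x = partialD i f x * f' x + f x * partialD i f' x := by
  unfold partialD
  rw [fderiv_fun_mul (hf.differentiableAt (by simp)) (hf'.differentiableAt (by simp))]
  simp
  ring

theorem partialD_sum {ι : Type*} (s : Finset ι) {F : ι → Coord n → ℝ} (i : Fin n)
    (hF : ∀ p, ContDiffAt ℝ ∞ (F p) x) :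
    partialD i (fun y => ∑ p ∈ s, F p y) x = ∑ p ∈ s, partialD i (F p) x := by
  unfold partialD
  rw [fderiv_fun_sum fun p _ => (hF p).differentiableAt (by simp)]
  simp

theorem partialD_congr (i : Fin n) (h : f =ᶠ[nhds x] f') : partialD i f x = partialD i f' x := by
  unfold partialD
  rw [h.fderiv_eq]

theorem ContDiffAt.partialD (i : Fin n) (hf : ContDiffAt ℝ ∞ f x) :
    ContDiffAt ℝ ∞ (partialD i f) x :=
  (hf.fderiv_right (m := ∞) (by simp)).clm_apply contDiffAt_const

theorem partialD_comm (i j : Fin n) (hf : ContDiffAt ℝ ∞ f x) :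
    partialD i (partialD j f) x = partialD j (partialD i f) x := by
  have hd : DifferentiableAt ℝ (fderiv ℝ f) x :=
    (hf.fderiv_right (m := ∞) (by simp)).differentiableAt (by simp)
  have h1 : ∀ a b : Fin n, _root_.partialD a (_root_.partialD b f) x
      = fderiv ℝ (fderiv ℝ f) x (EuclideanSpace.single a 1) (EuclideanSpace.single b 1) := by
    intro a b
    show fderiv ℝ (fun y => fderiv ℝ f y (EuclideanSpace.single b (1 : ℝ))) x _ = _
    rw [fderiv_clm_apply hd (differentiableAt_const _)]
    simp
  rw [h1, h1]
  -- Over `ℝ` the smoothness threshold for symmetric second derivatives is 2.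
  exact (hf.isSymmSndFDerivAt (by
    rw [minSmoothness_of_isRCLikeNormedField]; exact WithTop.coe_le_coe.mpr le_top)).eq _ _

/-- The matrix valued function `A` has smooth entries at `x`. -/
def SmoothMatAt (A : Coord n → Matrix (Fin n) (Fin n) ℝ) (x : Coord n) : Prop :=
  ∀ a b, ContDiffAt ℝ ∞ (fun y => A y a b) x

/-- The `i`-th partial derivative of a matrix valued function. -/
noncomputable def matD (i : Fin n) (A : Coord n → Matrix (Fin n) (Fin n) ℝ) (x : Coord n) :
    Matrix (Fin n) (Fin n) ℝ :=
  Matrix.of fun a b => partialD i (fun y => A y a b) x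

variable {A B : Coord n → Matrix (Fin n) (Fin n) ℝ}

theorem SmoothMatAt.add (hA : SmoothMatAt A x) (hB : SmoothMatAt B x) :
    SmoothMatAt (fun y => A y + B y) x := fun a b => (hA a b).add (hB a b)

theorem SmoothMatAt.sub (hA : SmoothMatAt A x) (hB : SmoothMatAt B x) :
    SmoothMatAt (fun y => A y - B y) x := fun a b => (hA a b).sub (hB a b)

theorem SmoothMatAt.mul (hA : SmoothMatAt A x) (hB : SmoothMatAt B x) :
    SmoothMatAt (fun y => A y * B y) x := fun a b => by
  simp only [Matrix.mul_apply]
  exact ContDiffAt.sum fun p _ => (hA a p).mul (hB p b)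

theorem SmoothMatAt.transpose (hA : SmoothMatAt A x) :
    SmoothMatAt (fun y => (A y).transpose) x := fun a b => hA b a

theorem SmoothMatAt.matD (i : Fin n) (hA : SmoothMatAt A x) : SmoothMatAt (matD i A) x :=
  fun a b => (hA a b).partialD i

theorem matD_add (i : Fin n) (hA : SmoothMatAt A x) (hB : SmoothMatAt B x) :
    matD i (fun y => A y + B y) x = matD i A x + matD i B x := by
  ext a b
  exact partialD_add i (hA a b) (hB a b)

theorem matD_sub (i : Fin n) (hA : SmoothMatAt A x) (hB : SmoothMatAt B x) :
    matD i (fun y => A y - B y) x = matD i A x - matD i B x := by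
  ext a b
  exact partialD_sub i (hA a b) (hB a b)

theorem matD_mul (i : Fin n) (hA : SmoothMatAt A x) (hB : SmoothMatAt B x) :
    matD i (fun y => A y * B y) x = matD i A x * B x + A x * matD i B x := by
  ext a b
  simp only [matD, Matrix.of_apply, Matrix.mul_apply, Matrix.add_apply]
  rw [partialD_sum _ i fun p => (hA a p).mul (hB p b), ← Finset.sum_add_distrib]
  exact Finset.sum_congr rfl fun p _ => partialD_mul i (hA a p) (hB p b)

theorem matD_transpose (i : Fin n) :
    matD i (fun y => (A y).transpose) x = (matD i A x).transpose := rfl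

theorem matD_comm (i j : Fin n) (hA : SmoothMatAt A x) :
    matD i (matD j A) x = matD j (matD i A) x := by
  ext a b
  exact partialD_comm i j (hA a b)

theorem matD_congr (i : Fin n) (h : A =ᶠ[nhds x] B) : matD i A x = matD i B x := by
  ext a b
  exact partialD_congr i (h.mono fun y hy => by simp only [hy])

theorem SmoothMatAt.det (hA : SmoothMatAt A x) : ContDiffAt ℝ ∞ (fun y => (A y).det) x := by
  simp only [Matrix.det_apply']
  exact ContDiffAt.sum fun σ _ => contDiffAt_const.mul (contDiffAt_prod fun i _ => hA _ _)

/-- Cramer's rule: entries of the inverse are determinants of row-modified matrices divided by `det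
A`. -/
theorem SmoothMatAt.inv (hA : SmoothMatAt A x) (h0 : (A x).det ≠ 0) :
    SmoothMatAt (fun y => (A y)⁻¹) x := fun a b => by
  simp only [Matrix.inv_def, Matrix.smul_apply, smul_eq_mul, Ring.inverse_eq_inv',
    Matrix.adjugate_apply]
  refine (hA.det.inv h0).mul (SmoothMatAt.det fun c d => ?_)
  by_cases hc : c = b
  · subst hc
    simpa using contDiffAt_const
  · simpa [Matrix.updateRow_ne hc] using hA c d

theorem SmoothMatAt.eventually_det_ne_zero (hA : SmoothMatAt A x) (h0 : (A x).det ≠ 0) :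
    ∀ᶠ y in nhds x, (A y).det ≠ 0 :=
  hA.det.continuousAt.eventually_ne h0

end PartialDerivatives

/-! ### Curvature identities in coordinates -/

namespace LocalMetric

variable {n : ℕ} {G : Coord n → Matrix (Fin n) (Fin n) ℝ} {x : Coord n}

theorem christoffel_symm (hG : ∀ y i j, G y i j = G y j i) (k i j : Fin n) :
    christoffel G k i j = christoffel G k j i := by
  funext y
  unfold christoffel
  congr 1
  refine Finset.sum_congr rfl fun l _ => ?_
  have : (fun y => G y i j) = fun y => G y j i := funext fun y => hG y i j
  rw [this]
  ring

theorem inv_symm (hG : ∀ y i j, G y i j = G y j i) (y : Coord n) (i j : Fin n) :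
    (G y)⁻¹ i j = (G y)⁻¹ j i := by
  have h : (G y).transpose = G y := by ext i j; exact hG y j i
  calc (G y)⁻¹ i j = ((G y)⁻¹).transpose j i := rfl
    _ = (G y)⁻¹ j i := by rw [Matrix.transpose_nonsing_inv, h]

/-- Lowering an index after raising it. -/
theorem sum_inv_mul (h0 : (G x).det ≠ 0) (F : Fin n → ℝ) (m : Fin n) :
    ∑ p, (∑ l, F l * (G x)⁻¹ l p) * G x p m = F m := by
  have h1 : (G x)⁻¹ * G x = 1 := Matrix.nonsing_inv_mul _ (isUnit_iff_ne_zero.mpr h0)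
  have h2 : ∀ l, ∑ p, F l * (G x)⁻¹ l p * G x p m
      = F l * (1 : Matrix (Fin n) (Fin n) ℝ) l m := by
    intro l
    rw [← h1, Matrix.mul_apply, Finset.mul_sum]
    exact Finset.sum_congr rfl fun p _ => by ring
  simp only [Finset.sum_mul]
  rw [Finset.sum_comm]
  simp [h2, Matrix.one_apply]

theorem sum_christoffel_mul (hG : ∀ y i j, G y i j = G y j i) (h0 : (G x).det ≠ 0)
    (i j m : Fin n) :
    ∑ p, christoffel G p i j x * G x p m = (1 / 2 : ℝ) * (partialD i (fun y => G y j m) x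
      + partialD j (fun y => G y i m) x - partialD m (fun y => G y i j) x) := by
  rw [← sum_inv_mul h0 (fun m => (1 / 2 : ℝ) * (partialD i (fun y => G y j m) x
      + partialD j (fun y => G y i m) x - partialD m (fun y => G y i j) x)) m]
  refine Finset.sum_congr rfl fun p _ => ?_
  congr 1
  rw [christoffel, Finset.mul_sum]
  exact Finset.sum_congr rfl fun l _ => by rw [inv_symm hG]; ring

/-- The Levi-Civita connection is metric. -/
theorem partialD_metric (hG : ∀ y i j, G y i j = G y j i) (h0 : (G x).det ≠ 0)
    (i j m : Fin n) :
    partialD i (fun y => G y j m) x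
      = ∑ p, christoffel G p i j x * G x p m + ∑ p, christoffel G p i m x * G x j p := by
  have h1 : ∑ p, christoffel G p i m x * G x j p = ∑ p, christoffel G p i m x * G x p j :=
    Finset.sum_congr rfl fun p _ => by rw [hG x j p]
  have h2 : (fun y => G y m j) = fun y => G y j m := funext fun y => hG y m j
  rw [h1, sum_christoffel_mul hG h0, sum_christoffel_mul hG h0, h2]
  ring

/-! ### Connection and curvature as matrices; Bianchi identities -/

variable (G) in
/-- The connection matrix `(Γⱼ)ᵐₗ = Γᵐⱼₗ`. -/
noncomputable def connMat (j : Fin n) (y : Coord n) : Matrix (Fin n) (Fin n) ℝ :=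
  Matrix.of fun m l => christoffel G m j l y

variable (G) in
/-- The curvature matrix `(R_{jk})ᵐₗ = R_{jkl}{}ᵐ`. -/
noncomputable def curvMat (j k : Fin n) (y : Coord n) : Matrix (Fin n) (Fin n) ℝ :=
  Matrix.of fun m l => riemann G j k l m y

/-- This is `∂ₖΓⱼ - ∂ⱼΓₖ + [Γₖ, Γⱼ]`, the negative of the usual curvature of `d + Γ`, because the
sign convention refers to covectors. In this form the curvature identities become noncommutative
ring identities. -/
theorem curvMat_eq (j k : Fin n) (y : Coord n) :
    curvMat G j k y = matD k (connMat G j) y - matD j (connMat G k) y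
      + (connMat G k y * connMat G j y - connMat G j y * connMat G k y) := by
  ext m l
  simp only [curvMat, riemann, connMat, matD, Matrix.of_apply, Matrix.add_apply,
    Matrix.sub_apply, Matrix.mul_apply, ← Finset.sum_sub_distrib]
  congr 1
  exact Finset.sum_congr rfl fun p _ => by ring

theorem matD_metric (hG : ∀ y i j, G y i j = G y j i) (h0 : (G x).det ≠ 0) (i : Fin n) :
    matD i G x = (connMat G i x).transpose * G x + G x * connMat G i x := by
  ext a b
  simp only [matD, connMat, Matrix.of_apply, Matrix.add_apply, Matrix.mul_apply,
    Matrix.transpose_apply]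
  rw [partialD_metric hG h0]
  congr 1
  exact Finset.sum_congr rfl fun p _ => by ring

theorem smoothMatAt_connMat (hs : SmoothMatAt G x) (h0 : (G x).det ≠ 0) (j : Fin n) :
    SmoothMatAt (connMat G j) x := fun m l => by
  simp only [connMat, Matrix.of_apply]
  unfold christoffel
  exact contDiffAt_const.mul (ContDiffAt.sum fun p _ => ((hs.inv h0) m p).mul
    ((((hs l p).partialD j).add ((hs j p).partialD l)).sub ((hs j l).partialD p)))

theorem smoothMatAt_curvMat (hs : SmoothMatAt G x) (h0 : (G x).det ≠ 0) (j k : Fin n) :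
    SmoothMatAt (curvMat G j k) x := by
  have h := smoothMatAt_connMat hs h0
  rw [show curvMat G j k = _ from funext (curvMat_eq j k)]
  exact (((h j).matD k).sub ((h k).matD j)).add (((h k).mul (h j)).sub ((h j).mul (h k)))

theorem curvMat_antisymm (j k : Fin n) (y : Coord n) : curvMat G j k y = -curvMat G k j y := by
  rw [curvMat_eq, curvMat_eq]
  abel

theorem riemann_antisymm (j k l m : Fin n) (y : Coord n) :
    riemann G j k l m y = -riemann G k j l m y :=
  congrFun (congrFun (curvMat_antisymm j k y) m) l

/-- The first Bianchi identity. -/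
theorem riemann_cyclic (hG : ∀ y i j, G y i j = G y j i) (j k l m : Fin n) (y : Coord n) :
    riemann G j k l m y + riemann G k l j m y + riemann G l j k m y = 0 := by
  unfold riemann
  rw [christoffel_symm hG m l j, christoffel_symm hG m l k, christoffel_symm hG m k j]
  have : ∀ a b c d e f : ℝ, ∀ A B C : ℝ, A + B + C = 0 → a = d → b = e → c = f →
      (a - b + A) + (c - d + B) + (e - f + C) = 0 := by
    intros; linarith
  refine this _ _ _ _ _ _ _ _ _ ?_ rfl rfl rfl
  rw [← Finset.sum_add_distrib, ← Finset.sum_add_distrib]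
  refine Finset.sum_eq_zero fun p _ => ?_
  rw [christoffel_symm hG p l j, christoffel_symm hG p l k, christoffel_symm hG p k j]
  ring

/-- The second Bianchi identity, in matrix form. -/
theorem curvMat_bianchi (hs : SmoothMatAt G x) (h0 : (G x).det ≠ 0) (i j k : Fin n) :
    (matD i (curvMat G j k) x
        + (connMat G i x * curvMat G j k x - curvMat G j k x * connMat G i x))
      + (matD j (curvMat G k i) x
        + (connMat G j x * curvMat G k i x - curvMat G k i x * connMat G j x))
      + (matD k (curvMat G i j) x
        + (connMat G k x * curvMat G i j x - curvMat G i j x * connMat G k x)) = 0 := by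
  have h := smoothMatAt_connMat hs h0
  have hd : ∀ i j k, matD i (curvMat G j k) x
      = matD i (matD k (connMat G j)) x - matD i (matD j (connMat G k)) x
        + ((matD i (connMat G k) x * connMat G j x + connMat G k x * matD i (connMat G j) x)
          - (matD i (connMat G j) x * connMat G k x
            + connMat G j x * matD i (connMat G k) x)) := by
    intro i j k
    rw [show curvMat G j k = _ from funext (curvMat_eq j k),
      matD_add i (((h j).matD k).sub ((h k).matD j)) (((h k).mul (h j)).sub ((h j).mul (h k))),
      matD_sub i ((h j).matD k) ((h k).matD j),
      matD_sub i ((h k).mul (h j)) ((h j).mul (h k)), matD_mul i (h k) (h j),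
      matD_mul i (h j) (h k)]
  rw [hd, hd, hd, curvMat_eq j k, curvMat_eq k i, curvMat_eq i j,
    matD_comm i k (h j), matD_comm i j (h k), matD_comm j k (h i)]
  noncomm_ring

variable (G) in
/-- The fully covariant Riemann tensor as a matrix in its last two indices. -/
noncomputable def curvLowMat (j k : Fin n) (y : Coord n) : Matrix (Fin n) (Fin n) ℝ :=
  (curvMat G j k y).transpose * G y

/-- `R_{jklm} = - R_{jkml}`, in matrix form. -/
theorem curvMat_metric (hG : ∀ y i j, G y i j = G y j i) (hs : SmoothMatAt G x)
    (h0 : (G x).det ≠ 0) (j k : Fin n) :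
    (curvMat G j k x).transpose * G x + G x * curvMat G j k x = 0 := by
  have h := smoothMatAt_connMat hs h0
  -- Metric compatibility is needed on a neighbourhood, since it is differentiated again; equating
  -- the mixed second derivatives of `G` gives the claim.
  have hD : ∀ i, matD i G =ᶠ[nhds x]
      fun y => (connMat G i y).transpose * G y + G y * connMat G i y := fun i =>
    (hs.eventually_det_ne_zero h0).mono fun y hy => matD_metric hG hy i
  have h2 : ∀ j k, matD k (matD j G) x
      = ((matD k (connMat G j) x).transpose * G x + (connMat G j x).transpose * matD k G x)
        + (matD k G x * connMat G j x + G x * matD k (connMat G j) x) := by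
    intro j k
    rw [matD_congr k (hD j), matD_add k ((h j).transpose.mul hs) (hs.mul (h j)),
      matD_mul k (h j).transpose hs, matD_mul k hs (h j), matD_transpose]
  have h3 := matD_comm k j hs
  rw [h2, h2, matD_metric hG h0 k, matD_metric hG h0 j] at h3
  rw [curvMat_eq]
  simp only [Matrix.transpose_add, Matrix.transpose_sub, Matrix.transpose_mul]
  rw [← sub_eq_zero] at h3
  rw [← h3]
  noncomm_ring

theorem curvLowMat_apply (j k l m : Fin n) (y : Coord n) :
    curvLowMat G j k y l m = ∑ p, riemann G j k l p y * G y p m := rfl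

theorem curvLowMat_antisymm (j k l m : Fin n) (y : Coord n) :
    curvLowMat G j k y l m = -curvLowMat G k j y l m := by
  rw [curvLowMat, curvMat_antisymm, Matrix.transpose_neg, Matrix.neg_mul]
  rfl

theorem curvLowMat_antisymm' (hG : ∀ y i j, G y i j = G y j i) (hs : SmoothMatAt G x)
    (h0 : (G x).det ≠ 0) (j k l m : Fin n) :
    curvLowMat G j k x l m = -curvLowMat G j k x m l := by
  have h1 := congrFun (congrFun (curvMat_metric hG hs h0 j k) l) m
  have h2 : (G x * curvMat G j k x) l m = curvLowMat G j k x m l := by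
    simp only [curvLowMat, Matrix.mul_apply, Matrix.transpose_apply]
    exact Finset.sum_congr rfl fun p _ => by rw [hG x l p]; ring
  rw [Matrix.add_apply, h2] at h1
  exact eq_neg_of_add_eq_zero_left h1

theorem curvLowMat_cyclic (hG : ∀ y i j, G y i j = G y j i) (j k l m : Fin n) (y : Coord n) :
    curvLowMat G j k y l m + curvLowMat G k l y j m + curvLowMat G l j y k m = 0 := by
  simp only [curvLowMat_apply, ← Finset.sum_add_distrib]
  exact Finset.sum_eq_zero fun p _ => by
    rw [← add_mul, ← add_mul, riemann_cyclic hG, zero_mul]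

/-- The classical octahedron argument: combine the four cyclic identities, one for each choice of
last index, with both antisymmetries. -/
theorem curvLowMat_pair_symm (hG : ∀ y i j, G y i j = G y j i) (hs : SmoothMatAt G x)
    (h0 : (G x).det ≠ 0) (j k l m : Fin n) :
    curvLowMat G j k x l m = curvLowMat G l m x j k := by
  have hc := fun j k l m => curvLowMat_cyclic hG j k l m x
  have ha := fun j k l m => curvLowMat_antisymm (G := G) j k l m x
  have hb := curvLowMat_antisymm' hG hs h0
  linarith [hc j k l m, hc k l m j, hc l m j k, hc m j k l, ha j k l m, ha k l m j, ha l m j k,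
    ha m j k l, hb j k l m, hb k l m j, hb l m j k, hb m j k l, ha j l k m, ha k m l j,
    hb k l j m, hb l j k m, hb l m k j, hb m k l j, hb m j l k, hb j l m k, hb j k m l,
    hb k m j l, ha l j k m, ha m k l j, ha j l m k, ha k m j l, ha k l j m, ha l m k j,
    ha m j l k, ha j k m l]

theorem smoothMatAt_curvLowMat (hs : SmoothMatAt G x) (h0 : (G x).det ≠ 0) (j k : Fin n) :
    SmoothMatAt (curvLowMat G j k) x :=
  (smoothMatAt_curvMat hs h0 j k).transpose.mul hs

/-- The second Bianchi identity for the fully covariant Riemann tensor. -/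
theorem covDeriv4_curvLowMat_cyclic (hG : ∀ y i j, G y i j = G y j i) (hs : SmoothMatAt G x)
    (h0 : (G x).det ≠ 0) (i j k l m : Fin n) :
    covDeriv4 G (fun j k l m y => curvLowMat G j k y l m) i j k l m x
      + covDeriv4 G (fun j k l m y => curvLowMat G j k y l m) j k i l m x
      + covDeriv4 G (fun j k l m y => curvLowMat G j k y l m) k i j l m x = 0 := by
  have hR := smoothMatAt_curvMat hs h0
  -- Since the connection is metric, lowering an index commutes with differentiation. The matrix
  -- term is the one in `curvMat_bianchi`; the two sums correct the form indices `j` and `k`.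
  have key : ∀ i j k l m, covDeriv4 G (fun j k l m y => curvLowMat G j k y l m) i j k l m x
      = ((matD i (curvMat G j k) x + (connMat G i x * curvMat G j k x
          - curvMat G j k x * connMat G i x)).transpose * G x) l m
        - ∑ p, christoffel G p i j x * curvLowMat G p k x l m
        - ∑ p, christoffel G p i k x * curvLowMat G j p x l m := by
    intro i j k l m
    have h1 : partialD i (fun y => curvLowMat G j k y l m) x = matD i (curvLowMat G j k) x l m :=
      rfl
    have h2 : matD i (curvLowMat G j k) x = (matD i (curvMat G j k) x).transpose * G x
        + (curvMat G j k x).transpose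
          * ((connMat G i x).transpose * G x + G x * connMat G i x) := by
      rw [← matD_metric hG h0, ← matD_transpose, ← matD_mul i (hR j k).transpose hs]
      rfl
    have h3 : ∑ p, christoffel G p i l x * curvLowMat G j k x p m
        = ((connMat G i x).transpose * curvLowMat G j k x) l m := rfl
    have h4 : ∑ p, christoffel G p i m x * curvLowMat G j k x l p
        = (curvLowMat G j k x * connMat G i x) l m := by
      rw [Matrix.mul_apply]
      exact Finset.sum_congr rfl fun p _ => mul_comm _ _
    have h5 : (matD i (curvMat G j k) x + (connMat G i x * curvMat G j k x
          - curvMat G j k x * connMat G i x)).transpose * G x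
        = matD i (curvLowMat G j k) x - (connMat G i x).transpose * curvLowMat G j k x
          - curvLowMat G j k x * connMat G i x := by
      rw [h2]
      simp only [curvLowMat, Matrix.transpose_add, Matrix.transpose_sub, Matrix.transpose_mul]
      noncomm_ring
    rw [covDeriv4, h1, h5, Matrix.sub_apply, Matrix.sub_apply, ← h3, ← h4]
    simp only [Finset.sum_add_distrib]
    ring
  -- Torsion-freeness and antisymmetry in the form indices make these corrections cancel in pairs
  -- over the cyclic sum.
  have hsw : ∀ i j k, ∑ p, christoffel G p i j x * curvLowMat G p k x l m
      = -∑ p, christoffel G p j i x * curvLowMat G k p x l m := by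
    intro i j k
    rw [← Finset.sum_neg_distrib]
    exact Finset.sum_congr rfl fun p _ => by
      rw [christoffel_symm hG p i j, curvLowMat_antisymm]; ring
  have h7 : ∀ A B C : Matrix (Fin n) (Fin n) ℝ, A + B + C = 0 →
      (A.transpose * G x) l m + (B.transpose * G x) l m + (C.transpose * G x) l m = 0 := by
    intro A B C hABC
    rw [← Matrix.add_apply, ← Matrix.add_apply, ← Matrix.add_mul, ← Matrix.add_mul,
      ← Matrix.transpose_add, ← Matrix.transpose_add, hABC]
    simp
  rw [key, key, key, hsw i j k, hsw j k i, hsw k i j]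
  linear_combination h7 _ _ _ (curvMat_bianchi hs h0 i j k)

end LocalMetric

/-! ### The Weyl tensor in coordinates -/

namespace LocalMetric

variable {n : ℕ} {G : Coord n → Matrix (Fin n) (Fin n) ℝ} {x : Coord n}

theorem weylUp_antisymm (j k l m : Fin n) (y : Coord n) :
    weylUp G j k l m y = -weylUp G k j l m y := by
  rw [weylUp, weylUp, riemann_antisymm]
  ring

theorem weyl_antisymm (j k l m : Fin n) (y : Coord n) :
    weyl G j k l m y = -weyl G k j l m y := by
  rw [weyl, weyl, ← Finset.sum_neg_distrib]
  exact Finset.sum_congr rfl fun p _ => by rw [weylUp_antisymm]; ring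

theorem sum_mul_inv (h0 : (G x).det ≠ 0) (F : Fin n → ℝ) (m : Fin n) :
    ∑ p, (∑ l, F l * G x l p) * (G x)⁻¹ p m = F m := by
  have h1 : G x * (G x)⁻¹ = 1 := Matrix.mul_nonsing_inv _ (isUnit_iff_ne_zero.mpr h0)
  have h2 : ∀ l, ∑ p, F l * G x l p * (G x)⁻¹ p m
      = F l * (1 : Matrix (Fin n) (Fin n) ℝ) l m := by
    intro l
    rw [← h1, Matrix.mul_apply, Finset.mul_sum]
    exact Finset.sum_congr rfl fun p _ => by ring
  simp only [Finset.sum_mul]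
  rw [Finset.sum_comm]
  simp [h2, Matrix.one_apply]

theorem weylUp_eq_sum_weyl (h0 : (G x).det ≠ 0) (j k l m : Fin n) :
    weylUp G j k l m x = ∑ p, weyl G j k l p x * (G x)⁻¹ p m :=
  (sum_mul_inv h0 (fun p => weylUp G j k l p x) m).symm

theorem ricci_symm (hG : ∀ y i j, G y i j = G y j i) (hs : SmoothMatAt G x)
    (h0 : (G x).det ≠ 0) (k l : Fin n) : ricci G k l x = ricci G l k x := by
  have h1 : ∀ k l, ricci G k l x = -∑ m, ∑ p, curvLowMat G m k x l p * (G x)⁻¹ p m := by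
    intro k l
    rw [ricci]
    congr 1
    exact Finset.sum_congr rfl fun m _ => (sum_mul_inv h0 (fun p => riemann G m k l p x) m).symm
  rw [h1, h1, Finset.sum_comm]
  congr 1
  refine Finset.sum_congr rfl fun p _ => Finset.sum_congr rfl fun m _ => ?_
  rw [curvLowMat_pair_symm hG hs h0, curvLowMat_antisymm, curvLowMat_antisymm' hG hs h0,
    inv_symm hG]
  ring

/-- The Weyl tensor is trace-free. -/
theorem sum_weylUp (hn : 5 ≤ n) (hG : ∀ y i j, G y i j = G y j i) (h0 : (G x).det ≠ 0)
    (k l : Fin n) : ∑ i, weylUp G i k l i x = 0 := by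
  have hn' : (5 : ℝ) ≤ n := by exact_mod_cast hn
  have hsc : ∑ i, ricciUp G i i x = scalarCurv G x := by
    simp only [ricciUp, scalarCurv]
    exact Finset.sum_congr rfl fun i _ => Finset.sum_congr rfl fun p _ => by
      rw [inv_symm hG]; ring
  have hup : ∑ i, ricciUp G k i x * G x i l = ricci G k l x :=
    sum_inv_mul h0 (fun p => ricci G k p x) l
  have hri : ∑ i, riemann G i k l i x = -ricci G k l x := by rw [ricci, neg_neg]
  have hd : ∀ F : Fin n → ℝ, ∑ i, delta k i * F i = F k := by
    intro F
    simp [delta]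
  have h1 : ∑ i, weylUp G i k l i x = ∑ i, riemann G i k l i x
      + (1 / ((n : ℝ) - 2)) * (∑ i : Fin n, ricci G k l x - ∑ i, delta k i * ricci G i l x
        + G x k l * ∑ i, ricciUp G i i x - ∑ i, ricciUp G k i x * G x i l)
      - scalarCurv G x * (∑ i : Fin n, G x k l - ∑ i, delta k i * G x i l)
        / (((n : ℝ) - 1) * ((n : ℝ) - 2)) := by
    simp only [div_eq_mul_inv, Finset.mul_sum, Finset.sum_mul, ← Finset.sum_add_distrib,
      ← Finset.sum_sub_distrib]
    refine Finset.sum_congr rfl fun i _ => ?_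
    rw [weylUp, show delta i i = 1 from if_pos rfl]
    ring
  rw [h1, hri, hsc, hup, hd, hd]
  simp only [Finset.sum_const, Finset.card_univ, Fintype.card_fin, nsmul_eq_mul]
  have h2 : (n : ℝ) - 2 ≠ 0 := by linarith
  have h3 : (n : ℝ) - 1 ≠ 0 := by linarith
  field_simp
  ring

theorem sum_inv_mul_weyl (hn : 5 ≤ n) (hG : ∀ y i j, G y i j = G y j i) (h0 : (G x).det ≠ 0)
    (k l : Fin n) : ∑ i, ∑ m, (G x)⁻¹ i m * weyl G i k l m x = 0 := by
  rw [← sum_weylUp hn hG h0 k l]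
  refine Finset.sum_congr rfl fun i _ => ?_
  rw [weylUp_eq_sum_weyl h0]
  exact Finset.sum_congr rfl fun m _ => by rw [inv_symm hG]; ring

/-! ### Schouten decomposition and the Bianchi identity for the Weyl tensor -/

variable (G) in
/-- The Schouten tensor. -/
noncomputable def schouten (k l : Fin n) (y : Coord n) : ℝ :=
  (1 / ((n : ℝ) - 2)) * (ricci G k l y - scalarCurv G y / (2 * ((n : ℝ) - 1)) * G y k l)

variable (G) in
/-- The Kulkarni–Nomizu product of the metric with the Schouten tensor. -/
noncomputable def metricSchouten (j k l m : Fin n) (y : Coord n) : ℝ :=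
  G y j m * schouten G k l y - G y k m * schouten G j l y
    + schouten G j m y * G y k l - schouten G k m y * G y j l

/-- The scalar curvature enters once through each Schouten factor, which explains the `2 * (n - 1)`
in `schouten`. Invertibility of `G x` is needed to lower the raised Ricci index. -/
theorem weyl_eq (hn : 5 ≤ n) (h0 : (G x).det ≠ 0) (j k l m : Fin n) :
    weyl G j k l m x = curvLowMat G j k x l m + metricSchouten G j k l m x := by
  have hn' : (5 : ℝ) ≤ n := by exact_mod_cast hn
  have h2 : (n : ℝ) - 2 ≠ 0 := by linarith
  have h3 : (n : ℝ) - 1 ≠ 0 := by linarith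
  have hup : ∀ k, ∑ p, ricciUp G k p x * G x p m = ricci G k m x :=
    fun k => sum_inv_mul h0 (fun p => ricci G k p x) m
  have hd : ∀ j, ∑ p, delta j p * G x p m = G x j m := by
    intro j
    simp [delta]
  have h1 : weyl G j k l m x = ∑ p, riemann G j k l p x * G x p m
      + (1 / ((n : ℝ) - 2)) * (ricci G k l x * ∑ p, delta j p * G x p m
        - ricci G j l x * ∑ p, delta k p * G x p m
        + G x k l * ∑ p, ricciUp G j p x * G x p m - G x j l * ∑ p, ricciUp G k p x * G x p m)
      - scalarCurv G x * (G x k l * ∑ p, delta j p * G x p m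
          - G x j l * ∑ p, delta k p * G x p m) / (((n : ℝ) - 1) * ((n : ℝ) - 2)) := by
    simp only [div_eq_mul_inv, Finset.mul_sum, Finset.sum_mul, ← Finset.sum_add_distrib,
      ← Finset.sum_sub_distrib, weyl]
    refine Finset.sum_congr rfl fun p _ => ?_
    rw [weylUp]
    ring
  rw [h1, hup, hup, hd, hd, ← curvLowMat_apply, metricSchouten]
  simp only [schouten]
  field_simp
  ring

theorem schouten_symm (hG : ∀ y i j, G y i j = G y j i) (hs : SmoothMatAt G x)
    (h0 : (G x).det ≠ 0) (k l : Fin n) : schouten G k l x = schouten G l k x := by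
  rw [schouten, schouten, ricci_symm hG hs h0, hG]

theorem weyl_antisymm' (hn : 5 ≤ n) (hG : ∀ y i j, G y i j = G y j i) (hs : SmoothMatAt G x)
    (h0 : (G x).det ≠ 0) (j k l m : Fin n) : weyl G j k l m x = -weyl G j k m l x := by
  rw [weyl_eq hn h0, weyl_eq hn h0, curvLowMat_antisymm' hG hs h0]
  simp only [metricSchouten]
  ring

theorem weyl_pair_symm (hn : 5 ≤ n) (hG : ∀ y i j, G y i j = G y j i) (hs : SmoothMatAt G x)
    (h0 : (G x).det ≠ 0) (j k l m : Fin n) : weyl G j k l m x = weyl G l m j k x := by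
  rw [weyl_eq hn h0, weyl_eq hn h0, curvLowMat_pair_symm hG hs h0]
  simp only [metricSchouten]
  rw [hG x l k, hG x m k, hG x m j, hG x l j, schouten_symm hG hs h0 m j,
    schouten_symm hG hs h0 l j, schouten_symm hG hs h0 l k, schouten_symm hG hs h0 m k]
  ring

theorem contDiffAt_ricci (hs : SmoothMatAt G x) (h0 : (G x).det ≠ 0) (k l : Fin n) :
    ContDiffAt ℝ ∞ (ricci G k l) x :=
  (ContDiffAt.sum fun m _ => smoothMatAt_curvMat hs h0 m k m l).neg

theorem contDiffAt_scalarCurv (hs : SmoothMatAt G x) (h0 : (G x).det ≠ 0) :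
    ContDiffAt ℝ ∞ (scalarCurv G) x :=
  ContDiffAt.sum fun i _ => ContDiffAt.sum fun j _ =>
    (hs.inv h0 i j).mul (contDiffAt_ricci hs h0 i j)

theorem contDiffAt_schouten (hs : SmoothMatAt G x) (h0 : (G x).det ≠ 0) (k l : Fin n) :
    ContDiffAt ℝ ∞ (schouten G k l) x :=
  contDiffAt_const.mul ((contDiffAt_ricci hs h0 k l).sub
    (((contDiffAt_scalarCurv hs h0).div_const _).mul (hs k l)))

theorem covDeriv4_congr {T T' : Fin n → Fin n → Fin n → Fin n → Coord n → ℝ}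
    (h : ∀ j k l m, T j k l m =ᶠ[nhds x] T' j k l m) (i j k l m : Fin n) :
    covDeriv4 G T i j k l m x = covDeriv4 G T' i j k l m x := by
  simp only [covDeriv4, partialD_congr i (h j k l m), (h _ _ _ _).eq_of_nhds]

theorem covDeriv4_add {T T' : Fin n → Fin n → Fin n → Fin n → Coord n → ℝ}
    (hT : ∀ j k l m, ContDiffAt ℝ ∞ (T j k l m) x)
    (hT' : ∀ j k l m, ContDiffAt ℝ ∞ (T' j k l m) x) (i j k l m : Fin n) :
    covDeriv4 G (fun j k l m y => T j k l m y + T' j k l m y) i j k l m x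
      = covDeriv4 G T i j k l m x + covDeriv4 G T' i j k l m x := by
  simp only [covDeriv4]
  rw [partialD_add i (hT j k l m) (hT' j k l m)]
  simp only [mul_add, Finset.sum_add_distrib]
  ring

variable (G) in
/-- The covariant derivative `∇ᵢ T_{kl}` of a covariant tensor of rank two. -/
noncomputable def covDeriv2 (T : Fin n → Fin n → Coord n → ℝ) (i k l : Fin n) (y : Coord n) : ℝ :=
  partialD i (T k l) y - ∑ p, christoffel G p i k y * T p l y
    - ∑ p, christoffel G p i l y * T k p y

/-- The Leibniz rule with `∇g = 0`: only the Schouten factors are differentiated. -/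
theorem covDeriv4_metricSchouten (hG : ∀ y i j, G y i j = G y j i) (hs : SmoothMatAt G x)
    (h0 : (G x).det ≠ 0) (i j k l m : Fin n) :
    covDeriv4 G (metricSchouten G) i j k l m x
      = G x j m * covDeriv2 G (schouten G) i k l x - G x k m * covDeriv2 G (schouten G) i j l x
        + covDeriv2 G (schouten G) i j m x * G x k l
        - covDeriv2 G (schouten G) i k m x * G x j l := by
  have hS := contDiffAt_schouten hs h0
  have h1 : partialD i (metricSchouten G j k l m) x
      = partialD i (fun y => G y j m) x * schouten G k l x
        + G x j m * partialD i (schouten G k l) x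
        - (partialD i (fun y => G y k m) x * schouten G j l x
          + G x k m * partialD i (schouten G j l) x)
        + (partialD i (schouten G j m) x * G x k l
          + schouten G j m x * partialD i (fun y => G y k l) x)
        - (partialD i (schouten G k m) x * G x j l
          + schouten G k m x * partialD i (fun y => G y j l) x) := by
    have a1 := (hs j m).mul (hS k l)
    have a2 := (hs k m).mul (hS j l)
    have a3 := (hS j m).mul (hs k l)
    have a4 := (hS k m).mul (hs j l)
    rw [← partialD_mul i (hs j m) (hS k l), ← partialD_mul i (hs k m) (hS j l),
      ← partialD_mul i (hS j m) (hs k l), ← partialD_mul i (hS k m) (hs j l),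
      ← partialD_sub i a1 a2, ← partialD_add i (a1.sub a2) a3,
      ← partialD_sub i ((a1.sub a2).add a3) a4]
    rfl
  have h2 : ∑ p, (christoffel G p i j x * metricSchouten G p k l m x
        + christoffel G p i k x * metricSchouten G j p l m x
        + christoffel G p i l x * metricSchouten G j k p m x
        + christoffel G p i m x * metricSchouten G j k l p x)
      = schouten G k l x * (∑ p, christoffel G p i j x * G x p m
          + ∑ p, christoffel G p i m x * G x j p)
        - schouten G j l x * (∑ p, christoffel G p i k x * G x p m
          + ∑ p, christoffel G p i m x * G x k p)
        + schouten G j m x * (∑ p, christoffel G p i k x * G x p l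
          + ∑ p, christoffel G p i l x * G x k p)
        - schouten G k m x * (∑ p, christoffel G p i j x * G x p l
          + ∑ p, christoffel G p i l x * G x j p)
        + G x j m * (∑ p, christoffel G p i k x * schouten G p l x
          + ∑ p, christoffel G p i l x * schouten G k p x)
        - G x k m * (∑ p, christoffel G p i j x * schouten G p l x
          + ∑ p, christoffel G p i l x * schouten G j p x)
        + G x k l * (∑ p, christoffel G p i j x * schouten G p m x
          + ∑ p, christoffel G p i m x * schouten G j p x)
        - G x j l * (∑ p, christoffel G p i k x * schouten G p m x
          + ∑ p, christoffel G p i m x * schouten G k p x) := by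
    simp only [Finset.mul_sum, ← Finset.sum_add_distrib, ← Finset.sum_sub_distrib]
    refine Finset.sum_congr rfl fun p _ => ?_
    simp only [metricSchouten]
    ring
  rw [covDeriv4, h1, h2, ← partialD_metric hG h0, ← partialD_metric hG h0,
    ← partialD_metric hG h0, ← partialD_metric hG h0]
  simp only [covDeriv2]
  ring

variable (G) in
/-- The Cotton tensor, as the skew-symmetrised covariant derivative of the Schouten tensor. -/
noncomputable def cotton (i k l : Fin n) (y : Coord n) : ℝ :=
  covDeriv2 G (schouten G) i k l y - covDeriv2 G (schouten G) k i l y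

/-- The second Bianchi identity for the Weyl tensor. -/
theorem covDeriv4_weyl_cyclic (hn : 5 ≤ n) (hG : ∀ y i j, G y i j = G y j i)
    (hs : SmoothMatAt G x) (h0 : (G x).det ≠ 0) (i j k l m : Fin n) :
    covDeriv4 G (weyl G) i j k l m x + covDeriv4 G (weyl G) j k i l m x
        + covDeriv4 G (weyl G) k i j l m x
      = G x j m * cotton G i k l x - G x j l * cotton G i k m x
        + G x k m * cotton G j i l x - G x k l * cotton G j i m x
        + G x i m * cotton G k j l x - G x i l * cotton G k j m x := by
  have hS := contDiffAt_schouten hs h0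
  have hMS : ∀ j k l m, ContDiffAt ℝ ∞ (metricSchouten G j k l m) x := fun j k l m =>
    ((((hs j m).mul (hS k l)).sub ((hs k m).mul (hS j l))).add
      ((hS j m).mul (hs k l))).sub ((hS k m).mul (hs j l))
  have h1 : ∀ i j k l m, covDeriv4 G (weyl G) i j k l m x
      = covDeriv4 G (fun j k l m y => curvLowMat G j k y l m) i j k l m x
        + covDeriv4 G (metricSchouten G) i j k l m x := by
    intro i j k l m
    rw [← covDeriv4_add (T := fun j k l m y => curvLowMat G j k y l m) (T' := metricSchouten G)
      (fun j k l m => smoothMatAt_curvLowMat hs h0 j k l m) hMS]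
    -- `weyl_eq` requires an invertible metric, an open condition, so the two sides agree near `x`
    -- and may be differentiated.
    exact covDeriv4_congr (fun j k l m => (hs.eventually_det_ne_zero h0).mono
      fun y hy => weyl_eq hn hy j k l m) i j k l m
  rw [h1, h1, h1, covDeriv4_metricSchouten hG hs h0, covDeriv4_metricSchouten hG hs h0,
    covDeriv4_metricSchouten hG hs h0]
  simp only [cotton]
  linear_combination covDeriv4_curvLowMat_cyclic hG hs h0 i j k l m

/-- If the Weyl tensor is recurrent at a point where the recurrence vector is not null, its
electric part along that vector is Weyl compatible. -/
theorem electric_weylCompatibleAt (hn : 5 ≤ n) (hG : ∀ y i j, G y i j = G y j i)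
    (hs : SmoothMatAt G x) (h0 : (G x).det ≠ 0) (a : Fin n → Coord n → ℝ)
    (hrec : ∀ i j k l m : Fin n,
      covDeriv4 G (weyl G) i j k l m x = a i x * weyl G j k l m x)
    (ha : normSq G a x ≠ 0) : WeylCompatibleAt G (electric G a) x := by
  intro i j k l
  have hB : ∀ i j k l m, a i x * weyl G j k l m x + a j x * weyl G k i l m x
      + a k x * weyl G i j l m x
      = G x j m * cotton G i k l x - G x j l * cotton G i k m x
        + G x k m * cotton G j i l x - G x k l * cotton G j i m x
        + G x i m * cotton G k j l x - G x i l * cotton G k j m x := by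
    intro i j k l m
    rw [← hrec, ← hrec, ← hrec, covDeriv4_weyl_cyclic hn hG hs h0]
  -- Compatibility is linear in the tensor, so the algebra is applied to the unnormalised electric
  -- part and divided by `normSq G a x` afterwards.
  obtain ⟨E, hE⟩ : ∃ E : Fin n → Fin n → ℝ, ∀ i l,
      E i l = ∑ j, ∑ k, weyl G i j k l x * raise G a j x * raise G a k x := ⟨_, fun _ _ => rfl⟩
  have hE' : ∀ i l, electric G a i l x = E i l / normSq G a x := fun i l => by
    rw [hE, electric]
  have key := electric_compatible_of_recurrent (g := G x) (h := (G x)⁻¹)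
    (C := fun j k l m => weyl G j k l m x) (u := fun i => a i x) (v := fun i => raise G a i x)
    (T := fun i k l => cotton G i k l x)
    (e := E)
    hn (Matrix.mul_nonsing_inv _ (isUnit_iff_ne_zero.mpr h0)) (hG x) (inv_symm hG x)
    (fun j k l m => weyl_antisymm j k l m x) (weyl_antisymm' hn hG hs h0)
    (weyl_pair_symm hn hG hs h0) (sum_inv_mul_weyl hn hG h0) (fun _ => rfl)
    (fun i k l => by simp only [cotton]; ring) hB ha hE i j k l
  rw [← zero_div (normSq G a x), ← key, Finset.sum_div]
  refine Finset.sum_congr rfl fun m _ => ?_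
  rw [hE', hE', hE', weylUp_eq_sum_weyl h0, weylUp_eq_sum_weyl h0, weylUp_eq_sum_weyl h0,
    Finset.sum_div]
  simp only [Finset.mul_sum, ← Finset.sum_add_distrib]
  exact Finset.sum_congr rfl fun p _ => by ring

end LocalMetric

/-! ### Components of a pseudo-Riemannian metric in a chart -/

section Charts

variable {n : ℕ} {M : Type*} [TopologicalSpace M] [ChartedSpace (Coord n) M]
  {e : OpenPartialHomeomorph M (Coord n)} {y : Coord n}

theorem mfderiv_symm_bijective [IsManifold (𝓡 n) ∞ M] (he : e ∈ smoothCharts n M)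
    (hy : y ∈ e.target) : Function.Bijective (mfderiv (𝓡 n) (𝓡 n) e.symm y) := by
  have h : e.MDifferentiable (𝓡 n) (𝓡 n) :=
    ⟨(contMDiffOn_of_mem_maximalAtlas he).mdifferentiableOn (by simp),
      (contMDiffOn_symm_of_mem_maximalAtlas he).mdifferentiableOn (by simp)⟩
  exact h.symm.mfderiv_bijective hy

/-- A kernel vector of the component matrix yields a tangent vector orthogonal to all coordinate
vectors. These span, so nondegeneracy makes it zero, and injectivity of the chart derivative makes
the kernel vector zero. -/
theorem PseudoRiemannianMetric.det_comp_ne_zero [IsManifold (𝓡 n) ∞ M]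
    (g : PseudoRiemannianMetric n M) (he : e ∈ smoothCharts n M) (hy : y ∈ e.target) :
    (g.comp e y).det ≠ 0 := by
  intro h0
  obtain ⟨v, hv, hGv⟩ := Matrix.exists_mulVec_eq_zero_iff.mpr h0
  obtain ⟨L, hL⟩ : ∃ L : Coord n →ₗ[ℝ] TangentSpace (𝓡 n) (e.symm y),
      (L : Coord n → _) = mfderiv (𝓡 n) (𝓡 n) e.symm y :=
    ⟨(mfderiv (𝓡 n) (𝓡 n) e.symm y).toLinearMap, rfl⟩
  have hbij : Function.Bijective L := hL ▸ mfderiv_symm_bijective he hy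
  have hcoord : ∀ i, coordVec e i y = L (EuclideanSpace.single i 1) := fun i => by
    rw [hL]; rfl
  have hsum : ∀ z : Coord n, z = ∑ i, z i • EuclideanSpace.single i (1 : ℝ) := fun z => by
    simpa using ((EuclideanSpace.basisFun (Fin n) ℝ).sum_repr z).symm
  have hform : ∀ i,
      g.form (e.symm y) (L (EuclideanSpace.single i 1)) (L (WithLp.toLp 2 v)) = 0 := by
    intro i
    rw [hsum (WithLp.toLp 2 v), map_sum, map_sum]
    refine Eq.trans ?_ (congrFun hGv i)
    refine Finset.sum_congr rfl fun j _ => ?_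
    rw [map_smul, map_smul, ← hcoord, ← hcoord, smul_eq_mul, mul_comm]
    rfl
  have hz : L (WithLp.toLp 2 v) = 0 := by
    refine g.nondegenerate _ _ fun w => ?_
    obtain ⟨z, rfl⟩ := hbij.2 w
    rw [g.symm, hsum z, map_sum, map_sum, LinearMap.sum_apply]
    exact Finset.sum_eq_zero fun i _ => by
      rw [map_smul, map_smul, LinearMap.smul_apply, hform, smul_zero]
  have := hbij.1 (hz.trans (map_zero L).symm)
  exact hv (funext fun i => congrArg (fun z : Coord n => z i) this)

theorem PseudoRiemannianMetric.smoothMatAt_comp (g : PseudoRiemannianMetric n M)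
    (he : e ∈ smoothCharts n M) (hy : y ∈ e.target) : SmoothMatAt (g.comp e) y := fun i j =>
  (g.smooth e he i j).contDiffAt (e.open_target.mem_nhds hy)

end Charts

theorem mainTheorem10 {n : ℕ} (hn : 5 ≤ n)
    {M : Type*} [TopologicalSpace M] [T2Space M] [ConnectedSpace M]
    [ChartedSpace (Coord n) M] [IsManifold (𝓡 n) ∞ M]
    (g : PseudoRiemannianMetric n M) (α : CovectorField n M)
    (hCR : g.IsConformallyRecurrent α) :
    ∀ e ∈ smoothCharts n M, ∀ y ∈ e.target,
      LocalMetric.normSq (g.comp e) (α.comp e) y ≠ 0 →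
      LocalMetric.WeylCompatibleAt (g.comp e)
        (LocalMetric.electric (g.comp e) (α.comp e)) y := by
  intro e he y hy hα
  have hs := g.smoothMatAt_comp he hy
  have h0 := g.det_comp_ne_zero he hy
  have hrec := hCR.2 e he y hy
  -- Symmetry holds for every `z`, also outside `e.target`, because `form` is symmetric whatever
  -- value `coordVec` takes there.
  have hsymm : ∀ z i j, g.comp e z i j = g.comp e z j i := fun _ _ _ => g.symm _ _ _
  generalize g.comp e = G at *
  exact LocalMetric.electric_weylCompatibleAt hn hsymm hs h0 (α.comp e) hrec hα
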